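/- Let $K(x,y)=\exp(-\|x-y\|_1)$ be the Laplacian kernel on $\mathbb{R}^d$. A map $\varphi:\mathbb{R}^d\to\mathcal{H}$ into a real Hilbert space is a feature mapping of $K$ if $\langle\varphi(x),\varphi(y)\rangle=K(x,y)$ for all $x,y$. For a map $f$ from $\mathbb{R}^d$ to a Hilbert space put $\mathrm{dist}_f(x,y)=\|f(x)-f(y)\|$. The random Fourier feature (RFF) map for $K$ with target dimension $D$ is $$\pi(x)=\sqrt{\tfrac1D}\,\bigl(\sin\langle\omega_1,x\rangle,\cos\langle\omega_1,x\rangle,\dots,\sin\langle\omega_D,x\rangle,\cos\langle\omega_D,x\rangle\bigr),$$ where $\omega_1,\dots,\omega_D\in\mathbb{R}^d$ are i.i.d. with density $\omega\mapsto(2\pi)^{-d}\int_{\mathbb{R}^d}e^{-\|x\|_1}e^{-i\langle\omega,x\rangle}\,dx$. For $\Delta\ge\rho>0$, a point $x\in\mathbb{R}^d$ is $(\Delta,\rho)$-bounded if $\|x\|_\infty\le\Delta$ and $|x_i|\ge\rho$ for every $i$ with $x_i\ne0$. Theorem. For every $p>0$ there is a constant $c>0$, depending only on $p$, such that the following holds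 for every dimension $d\ge1$ (in particular for $d=1$), all $\Delta\ge\rho>0$, all $0<\epsilon<1$, every feature mapping $\varphi:\mathbb{R}^d\to\mathcal{H}$ of $K$ and every natural number $D$. (i) If for all $(\Delta,\rho)$-bounded $x,y\in\mathbb{R}^d$ the RFF map $\pi$ for $K$ with target dimension $D$ satisfies $$\Pr\bigl[\,|\mathrm{dist}_\pi(x,y)-\mathrm{dist}_\varphi(x,y)|\le\epsilon\cdot\mathrm{dist}_\varphi(x,y)\,\bigr]\ge p,$$ then $D\ge c\cdot\frac1{\epsilon^2}\cdot\frac{\Delta}{\rho}$. (ii) If $\Delta\le1$ and $\epsilon\le\frac12$, the same conclusion holds already when the displayed inequality is only assumed for those $(\Delta,\rho)$-bounded $x,y$ whose difference $x-y$ is also $(\Delta,\rho)$-bounded. -/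

import Mathlib

open MeasureTheory

noncomputable section

/-- A point of `ℝ^d` is `(Δ, ρ)`-bounded if `‖x‖_∞ ≤ Δ` and every non-zero coordinate has absolute
value at least `ρ`. -/
def IsBoundedPoint {d : ℕ} (Δ ρ : ℝ) (x : EuclideanSpace ℝ (Fin d)) : Prop :=
  (∀ i, |x i| ≤ Δ) ∧ ∀ i, x i ≠ 0 → ρ ≤ |x i|

/-- The Laplacian kernel as a function of the difference: `K(z) = exp(-‖z‖₁)`. -/
def laplacianKernel (d : ℕ) (z : EuclideanSpace ℝ (Fin d)) : ℝ :=
  Real.exp (-∑ i, |z i|)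

/-- `φ : ℝ^d → H` is a feature mapping of the shift-invariant kernel `(x, y) ↦ K (x - y)`. -/
def IsFeatureMap {d : ℕ} (K : EuclideanSpace ℝ (Fin d) → ℝ)
    {H : Type*} [NormedAddCommGroup H] [InnerProductSpace ℝ H]
    (φ : EuclideanSpace ℝ (Fin d) → H) : Prop :=
  ∀ x y, inner ℝ (φ x) (φ y) = K (x - y)

/-- The distance that a map `f` into a normed space induces: `‖f x - f y‖`. -/
def inducedDist {X E : Type*} [NormedAddCommGroup E] (f : X → E) (x y : X) : ℝ :=
  ‖f x - f y‖

/-- The Fourier transform of `K`, normalized to a density: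
`p(ω) = (2π)^{-d} ∫ K(x) exp(-i⟨ω, x⟩) dx` (a real number, as `K` is even). -/
def spectralDensity {d : ℕ} (K : EuclideanSpace ℝ (Fin d) → ℝ)
    (ω : EuclideanSpace ℝ (Fin d)) : ℝ :=
  ((2 * Real.pi) ^ d)⁻¹ *
    (∫ x, (K x : ℂ) * Complex.exp (-(Complex.I * ((inner ℝ ω x : ℝ) : ℂ)))).re

/-- The distribution on `ℝ^d` with density `spectralDensity K`. -/
def spectralMeasure {d : ℕ} (K : EuclideanSpace ℝ (Fin d) → ℝ) :
    Measure (EuclideanSpace ℝ (Fin d)) :=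
  volume.withDensity fun ω => ENNReal.ofReal (spectralDensity K ω)

/-- The joint law of the i.i.d. frequencies `ω₁, …, ω_D`, each with density
`spectralDensity K`. -/
def frequencyLaw {d : ℕ} (K : EuclideanSpace ℝ (Fin d) → ℝ) (D : ℕ) :
    Measure (Fin D → EuclideanSpace ℝ (Fin d)) :=
  Measure.pi fun _ => spectralMeasure K

/-- The random Fourier feature map with frequencies `ω₁, …, ω_D`:
`π(x) = D^{-1/2} (sin⟨ω₁, x⟩, cos⟨ω₁, x⟩, …, sin⟨ω_D, x⟩, cos⟨ω_D, x⟩)`. -/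
def rffMap {d D : ℕ} (ω : Fin D → EuclideanSpace ℝ (Fin d))
    (x : EuclideanSpace ℝ (Fin d)) : EuclideanSpace ℝ (Fin D × Fin 2) :=
  WithLp.toLp 2 fun k =>
    √(1 / (D : ℝ)) * ![Real.sin (inner ℝ (ω k.1) x), Real.cos (inner ℝ (ω k.1) x)] k.2

/-- The probability, over the frequencies, that the random Fourier feature map for `K` with target
dimension `D` preserves the kernel distance of `x` and `y` up to a factor `1 ± ε`. -/
def rffSuccessProb {d : ℕ} (K : EuclideanSpace ℝ (Fin d) → ℝ)
    {H : Type*} [NormedAddCommGroup H] (φ : EuclideanSpace ℝ (Fin d) → H) (D : ℕ) (ε : ℝ)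
    (x y : EuclideanSpace ℝ (Fin d)) : ℝ :=
  (frequencyLaw K D).real
    {ω | |inducedDist (rffMap ω) x y - inducedDist φ x y| ≤ ε * inducedDist φ x y}

end

/-! Each coordinate of a frequency is standard Cauchy. For points that differ by `z` in one
coordinate, the squared feature distance is `2 / D` times `S = ∑ (1 - cos (z tₖ))` with `tₖ` i.i.d.
Cauchy, and `S` has mean `M = D (1 - exp (-z))`. Success forces `|S - M| ≤ 3 ε M` and `S ≥ (1 - ε)²
M`.

The core, `exists_div_sq_le_mean_of_cauchyLaw_success`, is that for `ε ≤ 1/2` this has probability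
at least `p` only if `M ≥ c / ε²`. A window of radius `L ≥ 2` has probability `O(L / √M)`, by an
Esseen argument (`cauchyLaw_abs_sub_le_le`); if `3 ε M ≥ 2`, the choice `L = 3 ε M` is enough.
Otherwise `L = 2` bounds `M` in terms of `p`, and heavy tails take over: `S` rarely reaches `(1 -
ε)² M` unless some `|tₖ| > δ / z`. This needs `M` bounded below, and with the other frequencies
fixed that one cosine must hit an interval of length `O(ε)` (`stdCauchy_real_cos_mem_interval_le`),
so `ε` is bounded below too.

Part (ii) is the case `z = ρ`, as `D ρ ≥ M` and `Δ ≤ 1`. In part (i) with `ρ < Δ`, bounded points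
can be arbitrarily close, where success has probability below `p` for any fixed `D`; so only `Δ = ρ`
can occur. -/

/-! ### The Cauchy distribution: characteristic function, tails, truncated moment. -/

/-- The standard Cauchy distribution on the line. -/
noncomputable abbrev stdCauchy : Measure ℝ := ProbabilityTheory.cauchyMeasure 0 1

/-- The density of the standard Cauchy distribution. -/
noncomputable def stdCauchyDensity (t : ℝ) : ℝ := Real.pi⁻¹ * (1 + t ^ 2)⁻¹

lemma stdCauchyDensity_nonneg (t : ℝ) : 0 ≤ stdCauchyDensity t := by
  unfold stdCauchyDensity; positivity

@[fun_prop]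
lemma measurable_stdCauchyDensity : Measurable stdCauchyDensity := by
  unfold stdCauchyDensity; fun_prop

lemma integrable_stdCauchyDensity : Integrable stdCauchyDensity :=
  integrable_inv_one_add_sq.const_mul _

lemma stdCauchy_eq_withDensity :
    stdCauchy = volume.withDensity fun t => ENNReal.ofReal (stdCauchyDensity t) := by
  rw [stdCauchy, ProbabilityTheory.cauchyMeasure_of_scale_ne_zero _ one_ne_zero]
  congr 1
  ext t
  simp [ProbabilityTheory.cauchyPDF, ProbabilityTheory.cauchyPDFReal, stdCauchyDensity, add_comm]

lemma integral_stdCauchy {E : Type*} [NormedAddCommGroup E] [NormedSpace ℝ E] (f : ℝ → E) :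
    ∫ t, f t ∂stdCauchy = ∫ t, stdCauchyDensity t • f t := by
  rw [stdCauchy_eq_withDensity, integral_withDensity_eq_integral_toReal_smul
    (by fun_prop) (by simp)]
  simp [ENNReal.toReal_ofReal, stdCauchyDensity_nonneg]

lemma stdCauchy_real_apply {s : Set ℝ} (hs : MeasurableSet s) :
    stdCauchy.real s = ∫ t in s, stdCauchyDensity t := by
  rw [stdCauchy_eq_withDensity, measureReal_def, withDensity_apply _ hs,
    ← integral_eq_lintegral_of_nonneg_ae (ae_of_all _ stdCauchyDensity_nonneg)]
  fun_prop

/-- The Fourier transform of `exp (-|x|)` is twice `π` times the Cauchy density. -/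
lemma integral_exp_neg_abs_mul_exp (w : ℝ) :
    Integrable (fun x : ℝ => ((Real.exp (-|x|) : ℝ) : ℂ) * Complex.exp (-(Complex.I * ((w * x : ℝ) : ℂ))))
    ∧ ∫ x : ℝ, ((Real.exp (-|x|) : ℝ) : ℂ) * Complex.exp (-(Complex.I * ((w * x : ℝ) : ℂ)))
      = ((2 * Real.pi * stdCauchyDensity w : ℝ) : ℂ) := by
  set f : ℝ → ℂ := fun x => ((Real.exp (-|x|) : ℝ) : ℂ) *
    Complex.exp (-(Complex.I * ((w * x : ℝ) : ℂ))) with hf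
  set a : ℂ := -1 - Complex.I * w with ha
  set b : ℂ := 1 - Complex.I * w with hb
  have har : a.re < 0 := by simp [ha]
  have hbr : 0 < b.re := by simp [hb]
  have h1 : Set.EqOn (fun x : ℝ => Complex.exp (a * x)) f (Set.Ioi 0) := by
    intro x hx
    simp only [hf, abs_of_pos (Set.mem_Ioi.1 hx), Complex.ofReal_exp, ← Complex.exp_add]
    congr 1
    push_cast [ha]; ring
  have h2 : Set.EqOn (fun x : ℝ => Complex.exp (b * x)) f (Set.Iic 0) := by
    intro x hx
    simp only [hf, abs_of_nonpos (Set.mem_Iic.1 hx), Complex.ofReal_exp, ← Complex.exp_add]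
    congr 1
    push_cast [hb]; ring
  have i1 : IntegrableOn f (Set.Ioi 0) :=
    (integrableOn_exp_mul_complex_Ioi har 0).congr_fun h1 measurableSet_Ioi
  have i2 : IntegrableOn f (Set.Iic 0) :=
    (integrableOn_exp_mul_complex_Iic hbr 0).congr_fun h2 measurableSet_Iic
  refine ⟨by simpa using i2.union i1, ?_⟩
  rw [← intervalIntegral.integral_Iic_add_Ioi i2 i1,
    ← setIntegral_congr_fun measurableSet_Ioi h1, ← setIntegral_congr_fun measurableSet_Iic h2,
    integral_exp_mul_complex_Ioi har, integral_exp_mul_complex_Iic hbr]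
  have ha0 : a ≠ 0 := fun h => by simp [h] at har
  have hb0 : b ≠ 0 := fun h => by simp [h] at hbr
  have hw : (1 + (w : ℂ) ^ 2) ≠ 0 := by
    norm_cast; positivity
  have hpi : (Real.pi : ℂ) ≠ 0 := by exact_mod_cast Real.pi_ne_zero
  have hab : a * b = -(1 + (w : ℂ) ^ 2) := by
    simp only [ha, hb]; linear_combination (w : ℂ) ^ 2 * Complex.I_sq
  have hsum : b⁻¹ - a⁻¹ = 2 * (1 + (w : ℂ) ^ 2)⁻¹ := by
    have : b⁻¹ - a⁻¹ = (a - b) * (a * b)⁻¹ := by field_simp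
    rw [this, hab, ha, hb, inv_neg]; ring
  simp only [Complex.ofReal_zero, mul_zero, Complex.exp_zero]
  push_cast [stdCauchyDensity]
  rw [show (2 * Real.pi * ((Real.pi : ℂ)⁻¹ * (1 + (w : ℂ) ^ 2)⁻¹)) = 2 * (1 + (w : ℂ) ^ 2)⁻¹ by
    field_simp, ← hsum]
  ring

open FourierTransform in
/-- The characteristic function of the standard Cauchy distribution is `exp (-|s|)`. -/
lemma integral_exp_stdCauchy (s : ℝ) :
    ∫ t, Complex.exp (((s * t : ℝ) : ℂ) * Complex.I) ∂stdCauchy = ((Real.exp (-|s|) : ℝ) : ℂ) := by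
  set f : ℝ → ℂ := fun x => ((Real.exp (-|x|) : ℝ) : ℂ) with hf
  have hfc : Continuous f := by fun_prop
  have hfi : Integrable f := by simpa [hf] using (integral_exp_neg_abs_mul_exp 0).1
  have hF : 𝓕 f = fun w => ((2 * Real.pi * stdCauchyDensity (2 * Real.pi * w) : ℝ) : ℂ) := by
    ext w
    rw [Real.fourier_eq', ← (integral_exp_neg_abs_mul_exp (2 * Real.pi * w)).2]
    congr 1
    ext x
    simp only [hf, smul_eq_mul, RCLike.inner_apply, conj_trivial]
    rw [mul_comm]
    congr 2
    push_cast
    ring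
  have hint : Integrable (𝓕 f) := by
    rw [hF]
    have := (integrable_stdCauchyDensity.comp_mul_left' (R := 2 * Real.pi) (by positivity)).const_mul
      (2 * Real.pi)
    exact this.ofReal
  -- Fourier inversion; the substitution `t = 2πv` below removes the `2π` of the convention for `𝓕`.
  have key := congrFun (hfc.fourierInv_fourier_eq hfi hint) s
  rw [Real.fourierInv_eq', hF] at key
  rw [integral_stdCauchy]
  change _ = f s
  rw [← key]
  have := Measure.integral_comp_mul_left (fun t : ℝ => stdCauchyDensity t •
    Complex.exp (((s * t : ℝ) : ℂ) * Complex.I)) (2 * Real.pi)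
  rw [abs_of_pos (by positivity), eq_inv_smul_iff₀ (by positivity)] at this
  rw [← this, ← integral_smul]
  congr 1
  ext v
  simp only [smul_eq_mul, RCLike.inner_apply, conj_trivial, Complex.real_smul]
  push_cast
  ring_nf

lemma integral_cos_stdCauchy (s : ℝ) :
    ∫ t, Real.cos (s * t) ∂stdCauchy = Real.exp (-|s|) := by
  have h := congrArg Complex.re (integral_exp_stdCauchy s)
  rw [Complex.ofReal_re, ← RCLike.re_eq_complex_re, ← integral_re] at h
  · rw [← h]
    congr 1
    ext t
    rw [RCLike.re_eq_complex_re, Complex.exp_ofReal_mul_I_re]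
  · refine Integrable.of_bound (C := 1) (by fun_prop) (ae_of_all _ fun t => ?_)
    rw [Complex.norm_exp_ofReal_mul_I]

/-- Each tail is `π⁻¹ arctan (1 / a)`, and `arctan x ≤ x`. -/
lemma stdCauchy_real_abs_gt {a : ℝ} (ha : 0 < a) : stdCauchy.real {t | a < |t|} ≤ 1 / a := by
  have hs : {t : ℝ | a < |t|} = Set.Iio (-a) ∪ Set.Ioi a := by
    ext t; simp [lt_abs, or_comm, lt_neg]
  have harc : Real.pi / 2 - Real.arctan a ≤ 1 / a := by
    rw [← Real.arctan_inv_of_pos ha, one_div]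
    have hlt := Real.arctan_lt_pi_div_two a⁻¹
    have := Real.le_tan (Real.arctan_nonneg.2 (inv_nonneg.2 ha.le)) hlt
    rwa [Real.tan_arctan] at this
  have h1 : stdCauchy.real (Set.Ioi a) = Real.pi⁻¹ * (Real.pi / 2 - Real.arctan a) := by
    rw [stdCauchy_real_apply measurableSet_Ioi, ← integral_Ioi_inv_one_add_sq, ← integral_const_mul]
    rfl
  have h2 : stdCauchy.real (Set.Iio (-a)) = Real.pi⁻¹ * (Real.pi / 2 - Real.arctan a) := by
    rw [stdCauchy_real_apply measurableSet_Iio, ← integral_Iic_eq_integral_Iio]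
    have := integral_Iic_inv_one_add_sq (i := -a)
    rw [Real.arctan_neg] at this
    rw [show Real.pi / 2 - Real.arctan a = -Real.arctan a + Real.pi / 2 by ring, ← this,
      ← integral_const_mul]
    rfl
  rw [hs]
  refine (measureReal_union_le _ _).trans ?_
  rw [h1, h2]
  have hpi : Real.pi⁻¹ ≤ 1 / 2 := by
    rw [one_div]; exact inv_anti₀ (by norm_num) Real.two_le_pi
  have hpos : 0 ≤ Real.pi / 2 - Real.arctan a := by linarith [Real.arctan_lt_pi_div_two a]
  nlinarith

/-- The truncated second moment of the standard Cauchy distribution. -/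
lemma integral_indicator_sq_stdCauchy {a : ℝ} (ha : 0 < a) :
    ∫ t, {t : ℝ | |t| ≤ a}.indicator (fun t => t ^ 2) t ∂stdCauchy ≤ a := by
  have hs : {t : ℝ | |t| ≤ a} = Set.Icc (-a) a := by ext t; simp [abs_le]
  rw [integral_stdCauchy, hs]
  have hpi : Real.pi⁻¹ ≤ 1 / 2 := by
    rw [one_div]; exact inv_anti₀ (by norm_num) Real.two_le_pi
  calc ∫ t, stdCauchyDensity t • (Set.Icc (-a) a).indicator (fun t => t ^ 2) t
      ≤ ∫ t, (Set.Icc (-a) a).indicator (fun _ => (1 / 2 : ℝ)) t := by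
        refine integral_mono_of_nonneg (ae_of_all _ fun t => ?_) ?_ (ae_of_all _ fun t => ?_)
        · exact smul_nonneg (stdCauchyDensity_nonneg t)
            (Set.indicator_nonneg (fun _ _ => sq_nonneg _) _)
        · exact (integrable_indicator_iff measurableSet_Icc).2 (by simp)
        · by_cases ht : t ∈ Set.Icc (-a) a
          · simp only [Set.indicator_of_mem ht, smul_eq_mul, stdCauchyDensity]
            have : (1 + t ^ 2)⁻¹ * t ^ 2 ≤ 1 := by
              rw [inv_mul_le_one₀ (by positivity)]; linarith
            have h0 : 0 ≤ (1 + t ^ 2)⁻¹ * t ^ 2 := by positivity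
            rw [mul_assoc]
            nlinarith
          · simp [Set.indicator_of_notMem ht]
    _ = a := by
        rw [integral_indicator measurableSet_Icc]
        simp; rw [max_eq_left (by linarith)]; ring

lemma stdCauchy_real_le_mul_volume {c : ℝ} {s : Set ℝ} (hs : MeasurableSet s)
    (hfin : volume s ≠ ⊤) (hc : ∀ t ∈ s, stdCauchyDensity t ≤ c) :
    stdCauchy.real s ≤ c * volume.real s := by
  rw [stdCauchy_real_apply hs]
  calc ∫ t in s, stdCauchyDensity t ≤ ∫ _t in s, c :=
        setIntegral_mono_on integrable_stdCauchyDensity.integrableOn (by simp [hfin.lt_top]) hs hc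
    _ = c * volume.real s := by simp [mul_comm]

/-! ### The spectral measure as a product of Cauchy laws. -/

/-- The ℓ₁ norm makes the kernel a product over coordinates, so its Fourier integral factors. -/
lemma spectralDensity_laplacianKernel {d : ℕ} (ω : EuclideanSpace ℝ (Fin d)) :
    spectralDensity (laplacianKernel d) ω = ∏ i, stdCauchyDensity (ω i) := by
  have hK : ∀ x : EuclideanSpace ℝ (Fin d), (laplacianKernel d x : ℂ) *
      Complex.exp (-(Complex.I * ((inner ℝ ω x : ℝ) : ℂ))) =
      (fun y : Fin d → ℝ => ∏ i, (((Real.exp (-|y i|) : ℝ) : ℂ) *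
        Complex.exp (-(Complex.I * ((ω i * y i : ℝ) : ℂ))))) (WithLp.ofLp x) := by
    intro x
    simp only [laplacianKernel, Finset.prod_mul_distrib, ← Complex.exp_sum, ← Complex.ofReal_prod,
      ← Real.exp_sum, Finset.sum_neg_distrib]
    congr 4
    rw [← Finset.mul_sum, PiLp.inner_apply, Complex.ofReal_sum]
    simp [mul_comm]
  have hI := (integral_congr_ae (μ := volume) (ae_of_all _ hK)).trans
    ((PiLp.volume_preserving_ofLp (Fin d)).integral_comp
      (MeasurableEquiv.toLp 2 (Fin d → ℝ)).symm.measurableEmbedding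
      fun y => ∏ i, (((Real.exp (-|y i|) : ℝ) : ℂ) *
        Complex.exp (-(Complex.I * ((ω i * y i : ℝ) : ℂ)))))
  rw [spectralDensity, hI, integral_fintype_prod_volume_eq_prod
    (fun i y => ((Real.exp (-|y|) : ℝ) : ℂ) * Complex.exp (-(Complex.I * ((ω i * y : ℝ) : ℂ))))]
  simp_rw [(integral_exp_neg_abs_mul_exp _).2]
  rw [← Complex.ofReal_prod, Complex.ofReal_re, Finset.prod_mul_distrib]
  simp only [Finset.prod_const, Finset.card_univ, Fintype.card_fin]
  field_simp

/-- The spectral measure of the Laplacian kernel is a product of Cauchy distributions. -/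
lemma map_ofLp_spectralMeasure (d : ℕ) :
    (spectralMeasure (laplacianKernel d)).map WithLp.ofLp = Measure.pi fun _ => stdCauchy := by
  refine (Measure.pi_eq fun s hs => ?_).symm
  have hms : MeasurableSet (Set.pi Set.univ s) := MeasurableSet.univ_pi hs
  have hmo : Measurable (WithLp.ofLp : EuclideanSpace ℝ (Fin d) → Fin d → ℝ) := by fun_prop
  rw [Measure.map_apply hmo hms, spectralMeasure, withDensity_apply _ (hmo hms)]
  simp_rw [spectralDensity_laplacianKernel]
  have hmp := PiLp.volume_preserving_ofLp (Fin d)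
  rw [hmp.setLIntegral_comp_preimage hms (f := fun y => ENNReal.ofReal (∏ i, stdCauchyDensity (y i)))
    (by fun_prop)]
  have hprod : ∀ y : Fin d → ℝ, (Set.pi Set.univ s).indicator
      (fun y => ∏ i, stdCauchyDensity (y i)) y = ∏ i, (s i).indicator stdCauchyDensity (y i) := by
    intro y
    by_cases hy : y ∈ Set.pi Set.univ s
    · rw [Set.indicator_of_mem hy]
      exact Finset.prod_congr rfl fun i _ => (Set.indicator_of_mem (hy i trivial) _).symm
    · rw [Set.indicator_of_notMem hy]
      obtain ⟨i, hi⟩ : ∃ i, y i ∉ s i := by simpa using hy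
      exact (Finset.prod_eq_zero (Finset.mem_univ i) (Set.indicator_of_notMem hi _)).symm
  have hint : Integrable (fun y : Fin d → ℝ => ∏ i, stdCauchyDensity (y i)) :=
    Integrable.fintype_prod (f := fun _ => stdCauchyDensity) fun _ => integrable_stdCauchyDensity
  rw [← ofReal_integral_eq_lintegral_ofReal hint.integrableOn
    (ae_of_all _ fun y => Finset.prod_nonneg fun i _ => stdCauchyDensity_nonneg _),
    ← integral_indicator hms]
  simp_rw [hprod]
  rw [integral_fintype_prod_volume_eq_prod (fun i => (s i).indicator stdCauchyDensity),
    ENNReal.ofReal_prod_of_nonneg fun i _ =>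
      integral_nonneg (Set.indicator_nonneg fun t _ => stdCauchyDensity_nonneg t)]
  refine Finset.prod_congr rfl fun i _ => ?_
  rw [integral_indicator (hs i), ← stdCauchy_real_apply (hs i), ofReal_measureReal]

instance (d : ℕ) : IsProbabilityMeasure (spectralMeasure (laplacianKernel d)) := by
  have h : IsProbabilityMeasure ((spectralMeasure (laplacianKernel d)).map WithLp.ofLp) := by
    rw [map_ofLp_spectralMeasure]; infer_instance
  refine ⟨?_⟩
  have := h.measure_univ
  rwa [Measure.map_apply (by fun_prop) MeasurableSet.univ, Set.preimage_univ] at this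

lemma map_coord_spectralMeasure {d : ℕ} (i : Fin d) :
    (spectralMeasure (laplacianKernel d)).map (fun ω => ω i) = stdCauchy := by
  have h := congrArg (Measure.map (Function.eval i)) (map_ofLp_spectralMeasure d)
  rw [Measure.map_map (by fun_prop) (by fun_prop), Measure.pi_map_eval] at h
  simpa [Function.comp_def] using h

/-- The law of `D` independent standard Cauchy variables. -/
noncomputable abbrev cauchyLaw (D : ℕ) : Measure (Fin D → ℝ) := Measure.pi fun _ => stdCauchy

lemma map_coord_frequencyLaw {d : ℕ} (D : ℕ) (i : Fin d) :
    (frequencyLaw (laplacianKernel d) D).map (fun ω k => ω k i) = cauchyLaw D := by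
  have := Measure.pi_map_pi (μ := fun _ : Fin D => spectralMeasure (laplacianKernel d))
    (f := fun _ ω => ω i) (fun _ => by fun_prop)
  rw [frequencyLaw, this]
  simp_rw [map_coord_spectralMeasure]

instance (d D : ℕ) : IsProbabilityMeasure (frequencyLaw (laplacianKernel d) D) := by
  unfold frequencyLaw; infer_instance

/-! ### Reduction to a sum of functions of Cauchy variables. -/

/-- The sum `∑ₖ (1 - cos (z tₖ))`; for the projected frequencies `t` it is proportional to the
squared distance of the images under the random Fourier feature map. -/
noncomputable def cosDefectSum {D : ℕ} (z : ℝ) (t : Fin D → ℝ) : ℝ :=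
  ∑ k, (1 - Real.cos (z * t k))

@[fun_prop]
lemma measurable_cosDefectSum {D : ℕ} (z : ℝ) : Measurable (cosDefectSum z : (Fin D → ℝ) → ℝ) := by
  unfold cosDefectSum; fun_prop

/-- Each sine-cosine pair contributes a squared chord of the unit circle, `2 (1 - cos)` of the angle
difference. -/
lemma inducedDist_rffMap_sq {d D : ℕ} (ω : Fin D → EuclideanSpace ℝ (Fin d))
    {x y : EuclideanSpace ℝ (Fin d)} {i : Fin d} {z : ℝ}
    (hxy : x - y = EuclideanSpace.single i z) :
    inducedDist (rffMap ω) x y ^ 2 = 2 / D * cosDefectSum z fun k => ω k i := by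
  have key : ∀ k, (Real.sin (inner ℝ (ω k) x) - Real.sin (inner ℝ (ω k) y)) ^ 2
      + (Real.cos (inner ℝ (ω k) x) - Real.cos (inner ℝ (ω k) y)) ^ 2
      = 2 * (1 - Real.cos (z * ω k i)) := by
    intro k
    have hin : z * ω k i = inner ℝ (ω k) x - inner ℝ (ω k) y := by
      rw [← inner_sub_right, hxy, EuclideanSpace.inner_single_right]; simp
    rw [hin, Real.cos_sub]
    linarith [Real.sin_sq_add_cos_sq (inner ℝ (ω k) x), Real.sin_sq_add_cos_sq (inner ℝ (ω k) y)]
  rw [inducedDist, EuclideanSpace.norm_sq_eq, Fintype.sum_prod_type]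
  simp only [rffMap, Fin.sum_univ_two, PiLp.sub_apply, Real.norm_eq_abs, sq_abs,
    Matrix.cons_val_zero, Matrix.cons_val_one, ← mul_sub, mul_pow, ← mul_add, key]
  rw [Real.sq_sqrt (by positivity), cosDefectSum, ← Finset.mul_sum, ← Finset.mul_sum]
  ring

lemma inducedDist_featureMap_sq {d : ℕ} {H : Type*} [NormedAddCommGroup H] [InnerProductSpace ℝ H]
    {φ : EuclideanSpace ℝ (Fin d) → H} (hφ : IsFeatureMap (laplacianKernel d) φ)
    {x y : EuclideanSpace ℝ (Fin d)} {i : Fin d} {z : ℝ} (hz : 0 ≤ z)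
    (hxy : x - y = EuclideanSpace.single i z) :
    inducedDist φ x y ^ 2 = 2 * (1 - Real.exp (-z)) := by
  have hs : laplacianKernel d (EuclideanSpace.single i z) = Real.exp (-z) := by
    rw [laplacianKernel, Finset.sum_eq_single i] <;> simp +contextual [abs_of_nonneg hz]
  have h0 : laplacianKernel d 0 = 1 := by simp [laplacianKernel]
  rw [inducedDist, ← real_inner_self_eq_norm_sq]
  rw [inner_sub_left, inner_sub_right, inner_sub_right, real_inner_comm (φ x) (φ y), hφ, hφ, hφ, hxy]
  simp only [sub_self, hs, h0]
  ring

/-- Success for a pair that differs by `z` in one coordinate is an event about Cauchy variables. -/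
lemma rffSuccessProb_le {d : ℕ} {H : Type*} [NormedAddCommGroup H] [InnerProductSpace ℝ H]
    {φ : EuclideanSpace ℝ (Fin d) → H} (hφ : IsFeatureMap (laplacianKernel d) φ)
    {x y : EuclideanSpace ℝ (Fin d)} {i : Fin d} {z ε : ℝ} (hz : 0 ≤ z) (hε : 0 < ε) (hε1 : ε < 1)
    (D : ℕ) (hD : 0 < D) (hxy : x - y = EuclideanSpace.single i z) :
    rffSuccessProb (laplacianKernel d) φ D ε x y ≤
      (cauchyLaw D).real {t | |cosDefectSum z t - D * (1 - Real.exp (-z))|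
          ≤ 3 * ε * (D * (1 - Real.exp (-z))) ∧
        (1 - ε) ^ 2 * (D * (1 - Real.exp (-z))) ≤ cosDefectSum z t} := by
  set m := 1 - Real.exp (-z) with hm
  have hmeas : MeasurableSet {t : Fin D → ℝ | |cosDefectSum z t - D * m| ≤ 3 * ε * (D * m) ∧
        (1 - ε) ^ 2 * (D * m) ≤ cosDefectSum z t} := by
    have h1 : MeasurableSet {t : Fin D → ℝ | |cosDefectSum z t - D * m| ≤ 3 * ε * (D * m)} :=
      measurableSet_le (by fun_prop) (by fun_prop)
    have h2 : MeasurableSet {t : Fin D → ℝ | (1 - ε) ^ 2 * (D * m) ≤ cosDefectSum z t} :=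
      measurableSet_le (by fun_prop) (by fun_prop)
    exact h1.inter h2
  rw [← map_coord_frequencyLaw D i, map_measureReal_apply (by fun_prop) hmeas]
  refine measureReal_mono fun ω hω => ?_
  simp only [Set.mem_ofPred_eq, Set.mem_preimage] at hω ⊢
  have h1 := inducedDist_rffMap_sq ω hxy
  have h2 := inducedDist_featureMap_sq hφ hz hxy
  rw [← hm] at h2
  set S := cosDefectSum z fun k => ω k i
  set a := inducedDist (rffMap ω) x y
  set b := inducedDist φ x y
  have ha : 0 ≤ a := norm_nonneg _
  have hb : 0 ≤ b := norm_nonneg _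
  have hD' : (0 : ℝ) < D := by exact_mod_cast hD
  have hS : S = D / 2 * a ^ 2 := by rw [h1]; field_simp
  have hM : D * m = D / 2 * b ^ 2 := by rw [h2]; ring
  obtain ⟨h3, h4⟩ := abs_le.1 hω
  have l1 : ((1 - ε) * b) ^ 2 ≤ a ^ 2 :=
    pow_le_pow_left₀ (mul_nonneg (by linarith) hb) (by linarith) 2
  have l2 : a ^ 2 ≤ ((1 + ε) * b) ^ 2 := pow_le_pow_left₀ ha (by linarith) 2
  have hD2 : (0 : ℝ) ≤ D / 2 := by positivity
  rw [hS, hM]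
  have hbb : 0 ≤ ε * b ^ 2 := by positivity
  -- Gives `2 ε + ε² ≤ 3 ε`, the source of the factor `3`.
  have hbb2 : ε * (ε * b ^ 2) ≤ 1 * (ε * b ^ 2) := mul_le_mul_of_nonneg_right hε1.le hbb
  refine ⟨abs_le.2 ⟨?_, ?_⟩, ?_⟩
  · have : (0:ℝ) ≤ D / 2 * (a ^ 2 - b ^ 2 + 3 * ε * b ^ 2) :=
      mul_nonneg hD2 (by nlinarith)
    linarith
  · have : (0:ℝ) ≤ D / 2 * (3 * ε * b ^ 2 - (a ^ 2 - b ^ 2)) :=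
      mul_nonneg hD2 (by nlinarith)
    linarith
  · have : (0:ℝ) ≤ D / 2 * (a ^ 2 - (1 - ε) ^ 2 * b ^ 2) :=
      mul_nonneg hD2 (by nlinarith)
    linarith

/-- With no coordinates the image distance is `0`, while the kernel distance is positive; a relative
error below `1` is impossible. -/
lemma rffSuccessProb_dim_zero {d : ℕ} {H : Type*} [NormedAddCommGroup H] [InnerProductSpace ℝ H]
    {φ : EuclideanSpace ℝ (Fin d) → H} (hφ : IsFeatureMap (laplacianKernel d) φ)
    {x y : EuclideanSpace ℝ (Fin d)} {i : Fin d} {z ε : ℝ} (hz : 0 < z) (hε1 : ε < 1)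
    (hxy : x - y = EuclideanSpace.single i z) :
    rffSuccessProb (laplacianKernel d) φ 0 ε x y = 0 := by
  have hb : 0 < inducedDist φ x y := by
    have h2 := inducedDist_featureMap_sq hφ hz.le hxy
    have : Real.exp (-z) < 1 := by simpa using hz
    exact lt_of_le_of_ne (norm_nonneg _) fun h => by
      rw [← h] at h2; linarith
  rw [rffSuccessProb]
  convert! measureReal_empty
  refine Set.eq_empty_of_forall_notMem fun ω hω => ?_
  have h0 : inducedDist (rffMap ω) x y = 0 := by
    have := inducedDist_rffMap_sq ω hxy
    simpa [cosDefectSum] using this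
  rw [Set.mem_ofPred_eq, h0, zero_sub, abs_neg, abs_of_pos hb] at hω
  nlinarith

/-! ### Anti-concentration through characteristic functions. -/

/-- The integral is the squared modulus of the Fourier transform of `I` at `u`. -/
lemma integral_cos_sub_mul_nonneg (I : Measure ℝ) [IsFiniteMeasure I] (u : ℝ) :
    0 ≤ ∫ p, Real.cos ((p.1 - p.2) * u) ∂(I.prod I) := by
  have hc : Integrable (fun s => Real.cos (s * u)) I :=
    Integrable.of_bound (C := 1) (by fun_prop) (ae_of_all _ fun p => Real.abs_cos_le_one _)
  have hs : Integrable (fun s => Real.sin (s * u)) I :=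
    Integrable.of_bound (C := 1) (by fun_prop) (ae_of_all _ fun p => Real.abs_sin_le_one _)
  have h : ∫ p, Real.cos ((p.1 - p.2) * u) ∂(I.prod I) =
      (∫ s, Real.cos (s * u) ∂I) * (∫ s, Real.cos (s * u) ∂I) +
        (∫ s, Real.sin (s * u) ∂I) * (∫ s, Real.sin (s * u) ∂I) := by
    rw [← integral_prod_mul, ← integral_prod_mul, ← integral_add (hc.mul_prod hc) (hs.mul_prod hs)]
    simp only [sub_mul, Real.cos_sub]
  rw [h]
  exact add_nonneg (mul_self_nonneg _) (mul_self_nonneg _)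

/-- A one-sided Esseen inequality: Gaussian decay of the characteristic function near the origin
bounds the mass of the unit interval. -/
lemma measureReal_abs_le_one_le {Ω : Type*} [MeasurableSpace Ω] (μ : Measure Ω)
    [IsProbabilityMeasure μ] {U : Ω → ℝ} (hU : Measurable U) {b : ℝ} (hb : 0 < b)
    (h : ∀ r, |r| ≤ 1 → ∫ x, Real.cos (r * U x) ∂μ ≤ Real.exp (-b * r ^ 2)) :
    μ.real {x | |U x| ≤ 1} ≤ 2 * √(Real.pi / b) := by
  let I : Measure ℝ := volume.restrict (Set.Icc 0 1)
  have hIp : IsProbabilityMeasure I := ⟨by simp [I]⟩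
  -- A nonnegative test function, at least `1/2` on `[-1, 1]`, that uses only the frequencies `p.1 -
  -- p.2` in `[-1, 1]`, where `h` applies.
  let k : ℝ → ℝ := fun u => ∫ p, Real.cos ((p.1 - p.2) * u) ∂(I.prod I)
  have hbd : ∀ f : ℝ × ℝ → ℝ, Measurable f → Integrable (fun p => Real.cos (f p)) (I.prod I) :=
    fun f hf => Integrable.of_bound (C := 1) (by fun_prop)
      (ae_of_all _ fun p => Real.abs_cos_le_one _)
  have hmem : ∀ᵐ p ∂(I.prod I), |p.1 - p.2| ≤ 1 := by
    have : I.prod I = (volume.prod volume).restrict (Set.Icc 0 1 ×ˢ Set.Icc 0 1) :=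
      Measure.prod_restrict _ _
    rw [this]
    filter_upwards [ae_restrict_mem (measurableSet_Icc.prod measurableSet_Icc)] with p hp
    obtain ⟨⟨h1, h2⟩, h3, h4⟩ := hp
    exact abs_le.2 ⟨by linarith, by linarith⟩
  have hk0 : ∀ u, 0 ≤ k u := integral_cos_sub_mul_nonneg I
  have hk1 : ∀ u, |u| ≤ 1 → 1 / 2 ≤ k u := by
    intro u hu
    have : ∫ _p, (1 / 2 : ℝ) ∂(I.prod I) ≤ k u := by
      refine integral_mono_ae (integrable_const _) (hbd _ (by fun_prop)) ?_
      filter_upwards [hmem] with p hp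
      have h1 : |(p.1 - p.2) * u| ≤ 1 := by
        rw [abs_mul]; exact mul_le_one₀ hp (abs_nonneg _) hu
      have h2 := Real.one_sub_sq_div_two_le_cos (x := (p.1 - p.2) * u)
      have h3 : ((p.1 - p.2) * u) ^ 2 ≤ 1 := (sq_le_one_iff_abs_le_one _).2 h1
      linarith
    simpa using this
  have hkint : Integrable (fun x => k (U x)) μ := by
    have : Integrable (fun q : Ω × (ℝ × ℝ) => Real.cos ((q.2.1 - q.2.2) * U q.1))
        (μ.prod (I.prod I)) := Integrable.of_bound (C := 1) (by fun_prop)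
          (ae_of_all _ fun p => Real.abs_cos_le_one _)
    exact this.integral_prod_left
  have hswap : ∫ x, k (U x) ∂μ = ∫ p, ∫ x, Real.cos ((p.1 - p.2) * U x) ∂μ ∂(I.prod I) := by
    refine integral_integral_swap (f := fun x (p : ℝ × ℝ) => Real.cos ((p.1 - p.2) * U x)) ?_
    exact Integrable.of_bound (C := 1) (by fun_prop)
          (ae_of_all _ fun p => Real.abs_cos_le_one _)
  have hE : Integrable (fun p : ℝ × ℝ => Real.exp (-b * (p.1 - p.2) ^ 2)) (I.prod I) := by
    refine Integrable.of_bound (C := 1) (by fun_prop) (ae_of_all _ fun p => ?_)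
    rw [Real.norm_eq_abs, Real.abs_exp, Real.exp_le_one_iff]
    nlinarith [sq_nonneg (p.1 - p.2)]
  have hup : ∫ x, k (U x) ∂μ ≤ √(Real.pi / b) := by
    rw [hswap]
    calc _ ≤ ∫ p, Real.exp (-b * (p.1 - p.2) ^ 2) ∂(I.prod I) := by
          refine integral_mono_ae ?_ hE ?_
          · have : Integrable (fun q : (ℝ × ℝ) × Ω => Real.cos ((q.1.1 - q.1.2) * U q.2))
              ((I.prod I).prod μ) := Integrable.of_bound (C := 1) (by fun_prop)
                (ae_of_all _ fun p => Real.abs_cos_le_one _)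
            exact this.integral_prod_left
          · filter_upwards [hmem] with p hp using h _ hp
      _ = ∫ s, ∫ t, Real.exp (-b * (s - t) ^ 2) ∂I ∂I := integral_prod _ hE
      _ ≤ ∫ _s, √(Real.pi / b) ∂I := by
          refine integral_mono hE.integral_prod_left (integrable_const _) fun s => ?_
          have hg : Integrable (fun t => Real.exp (-b * (s - t) ^ 2)) :=
            (integrable_exp_neg_mul_sq hb).comp_sub_left s
          refine (setIntegral_le_integral hg (ae_of_all _ fun t => (Real.exp_pos _).le)).trans_eq ?_
          rw [integral_sub_left_eq_self (fun t => Real.exp (-b * t ^ 2)), integral_gaussian]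
      _ = √(Real.pi / b) := by simp
  have hms : MeasurableSet {x | |U x| ≤ 1} := measurableSet_le (by fun_prop) (by fun_prop)
  have hlow : 1 / 2 * μ.real {x | |U x| ≤ 1} ≤ ∫ x, k (U x) ∂μ := by
    calc _ = ∫ x, {x | |U x| ≤ 1}.indicator (fun _ => (1 / 2 : ℝ)) x ∂μ := by
          rw [integral_indicator_const _ hms, smul_eq_mul, mul_comm]
      _ ≤ _ := by
          refine integral_mono ((integrable_const _).indicator hms) hkint fun x => ?_
          exact Set.indicator_le' (fun x hx => hk1 _ hx) (fun x _ => hk0 _) x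
  linarith

/-- `1 - exp (-z)`, the Cauchy mean of `1 - cos (z t)`, is at least of order `min 1 z`. -/
lemma min_le_two_mul_one_sub_exp {z : ℝ} (hz : 0 ≤ z) :
    min 1 z ≤ 2 * (1 - Real.exp (-z)) := by
  rw [Real.exp_neg]
  have h1 : 1 + z ≤ Real.exp z := by linarith [Real.add_one_le_exp z]
  have h2 : (Real.exp z)⁻¹ ≤ (1 + z)⁻¹ := inv_anti₀ (by linarith) h1
  have h3 : min 1 z ≤ 2 * (1 - (1 + z)⁻¹) := by
    have : 2 * (1 - (1 + z)⁻¹) = 2 * z / (1 + z) := by field_simp; ring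
    rw [this, le_div_iff₀ (by linarith)]
    rcases le_total 1 z with h | h
    · rw [min_eq_left h]; linarith
    · rw [min_eq_right h]; nlinarith
  linarith

/-- Near the origin, the characteristic function of `cos (z t)` decays like a Gaussian. -/
lemma norm_integral_exp_cos_stdCauchy_le {z u : ℝ} (hz : 0 < z) (hu : |u| ≤ 1 / 2) :
    ‖∫ t, Complex.exp (((u * (1 - Real.cos (z * t)) : ℝ) : ℂ) * Complex.I) ∂stdCauchy‖ ≤
      Real.exp (-((1 - Real.exp (-z)) / 8) * u ^ 2) := by
  set e := Real.exp (-z) with he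
  have he0 : 0 < e := Real.exp_pos _
  have he1 : e < 1 := by simpa [he] using hz
  -- Centring `1 - cos (z t)` costs only a phase of modulus one.
  set Y : ℝ → ℝ := fun t => e - Real.cos (z * t) with hY
  have hYm : Measurable Y := by fun_prop
  have hYb : ∀ t, |Y t| ≤ 2 := fun t =>
    abs_le.2 ⟨by linarith [Real.cos_le_one (z * t)], by linarith [Real.neg_one_le_cos (z * t)]⟩
  have hcos : Integrable (fun t => Real.cos (z * t)) stdCauchy :=
    Integrable.of_bound (C := 1) (by fun_prop) (ae_of_all _ fun p => Real.abs_cos_le_one _)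
  have hcos2 : Integrable (fun t => Real.cos (2 * z * t)) stdCauchy :=
    Integrable.of_bound (C := 1) (by fun_prop) (ae_of_all _ fun p => Real.abs_cos_le_one _)
  have hYi : Integrable Y stdCauchy := (integrable_const _).sub hcos
  have hYmean : ∫ t, Y t ∂stdCauchy = 0 := by
    rw [integral_sub (integrable_const _) hcos, integral_cos_stdCauchy, abs_of_pos hz]
    simp [he]
  have hY2 : ∀ t, Y t ^ 2 = (e ^ 2 + 1 / 2) + 1 / 2 * Real.cos (2 * z * t)
      - 2 * e * Real.cos (z * t) := by
    intro t
    rw [mul_assoc 2, Real.cos_two_mul]; simp only [hY]; ring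
  have hY2i : Integrable (fun t => Y t ^ 2) stdCauchy := by
    simp_rw [hY2]
    exact ((integrable_const _).add (hcos2.const_mul _)).sub (hcos.const_mul _)
  set v := (1 - e ^ 2) / 2 with hv
  have hYvar : ∫ t, Y t ^ 2 ∂stdCauchy = v := by
    simp_rw [hY2]
    have h1 : Integrable (fun t => (e ^ 2 + 1 / 2) + 1 / 2 * Real.cos (2 * z * t)) stdCauchy :=
      (integrable_const _).add (hcos2.const_mul _)
    rw [integral_sub h1 (hcos.const_mul _),
      integral_add (integrable_const _) (hcos2.const_mul _), integral_const_mul, integral_const_mul,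
      integral_cos_stdCauchy, integral_cos_stdCauchy, abs_of_pos hz, abs_of_pos (by positivity)]
    have : Real.exp (-(2 * z)) = e ^ 2 := by rw [he, ← Real.exp_nat_mul]; congr 1; push_cast; ring
    rw [this, ← he]
    simp only [integral_const, probReal_univ, smul_eq_mul, hv]; ring
  have hsplit : ∀ t, Complex.exp (((u * (1 - Real.cos (z * t)) : ℝ) : ℂ) * Complex.I) =
      Complex.exp (((u * (1 - e) : ℝ) : ℂ) * Complex.I) *
        Complex.exp (((u * Y t : ℝ) : ℂ) * Complex.I) := by
    intro t
    rw [← Complex.exp_add]; congr 1; simp only [hY]; push_cast; ring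
  simp_rw [hsplit]
  rw [integral_const_mul, norm_mul, Complex.norm_exp_ofReal_mul_I, one_mul]
  -- Second-order Taylor polynomial; since `|u Y| ≤ 1`, the cubic remainder is absorbed into a
  -- quadratic one.
  let T : ℝ → ℂ := fun t => 1 + ((u * Y t : ℝ) : ℂ) * Complex.I - ((u ^ 2 / 2 * Y t ^ 2 : ℝ) : ℂ)
  have hTi : Integrable T stdCauchy :=
    ((integrable_const _).add ((hYi.const_mul u).ofReal.mul_const _)).sub
      (hY2i.const_mul _).ofReal
  have hT : ∫ t, T t ∂stdCauchy = ((1 - u ^ 2 / 2 * v : ℝ) : ℂ) := by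
    simp only [T]
    have h1 : Integrable (fun t => ((u * Y t : ℝ) : ℂ) * Complex.I) stdCauchy :=
      (hYi.const_mul u).ofReal.mul_const _
    have h2 : Integrable (fun t => 1 + ((u * Y t : ℝ) : ℂ) * Complex.I) stdCauchy :=
      (integrable_const _).add h1
    have h3 : Integrable (fun t => ((u ^ 2 / 2 * Y t ^ 2 : ℝ) : ℂ)) stdCauchy :=
      (hY2i.const_mul _).ofReal
    rw [integral_sub h2 h3, integral_add (integrable_const _) h1,
      integral_mul_const, integral_complex_ofReal, integral_complex_ofReal,
      integral_const_mul, integral_const_mul, hYmean, hYvar]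
    simp
  have hexpi : Integrable (fun t => Complex.exp (((u * Y t : ℝ) : ℂ) * Complex.I)) stdCauchy :=
    Integrable.of_bound (C := 1) (by fun_prop)
      (ae_of_all _ fun t => (Complex.norm_exp_ofReal_mul_I _).le)
  have hrem : ∀ t, ‖Complex.exp (((u * Y t : ℝ) : ℂ) * Complex.I) - T t‖ ≤
      2 / 9 * u ^ 2 * Y t ^ 2 := by
    intro t
    have hn : ‖((u * Y t : ℝ) : ℂ) * Complex.I‖ = |u * Y t| := by simp
    have hle : |u * Y t| ≤ 1 := by
      rw [abs_mul]; nlinarith [hYb t, abs_nonneg u, abs_nonneg (Y t)]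
    have hb := Complex.exp_bound (x := ((u * Y t : ℝ) : ℂ) * Complex.I) (by rw [hn]; exact hle)
      (n := 3) (by norm_num)
    have hs : ∑ m ∈ Finset.range 3, (((u * Y t : ℝ) : ℂ) * Complex.I) ^ m / (m.factorial : ℂ)
        = T t := by
      simp only [Finset.sum_range_succ, Finset.sum_range_zero, T, mul_pow, Complex.I_sq]
      simp [Nat.factorial]; ring
    rw [hs, hn] at hb
    refine hb.trans ?_
    have h3 : |u * Y t| ^ 3 ≤ |u * Y t| ^ 2 := pow_le_pow_of_le_one (abs_nonneg _) hle (by norm_num)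
    rw [sq_abs, mul_pow] at h3
    have hc : ((Nat.succ 3 : ℝ) * ((Nat.factorial 3 : ℝ) * (3 : ℕ))⁻¹) = 2 / 9 := by
      norm_num [Nat.factorial]
    rw [hc]
    linarith
  have hdiff : ‖∫ t, Complex.exp (((u * Y t : ℝ) : ℂ) * Complex.I) ∂stdCauchy
      - ((1 - u ^ 2 / 2 * v : ℝ) : ℂ)‖ ≤ 2 / 9 * u ^ 2 * v := by
    rw [← hT, ← integral_sub hexpi hTi]
    refine (norm_integral_le_integral_norm _).trans ?_
    calc _ ≤ ∫ t, 2 / 9 * u ^ 2 * Y t ^ 2 ∂stdCauchy :=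
          integral_mono (hexpi.sub hTi).norm (hY2i.const_mul _) hrem
      _ = _ := by rw [integral_const_mul, hYvar]
  have hv0 : (1 - e) / 2 ≤ v := by rw [hv]; nlinarith
  have hv1 : v ≤ 1 := by rw [hv]; nlinarith
  have hu2 : u ^ 2 ≤ 1 / 4 := by
    rw [← sq_abs]; nlinarith [abs_nonneg u]
  have hmain : ‖((1 - u ^ 2 / 2 * v : ℝ) : ℂ)‖ = 1 - u ^ 2 / 2 * v := by
    rw [Complex.norm_real, Real.norm_eq_abs, abs_of_nonneg]
    nlinarith [sq_nonneg u]
  have htri := norm_le_norm_add_norm_sub' (∫ t, Complex.exp (((u * Y t : ℝ) : ℂ) * Complex.I)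
    ∂stdCauchy) ((1 - u ^ 2 / 2 * v : ℝ) : ℂ)
  have hfin := Real.add_one_le_exp (-((1 - e) / 8) * u ^ 2)
  -- The norm is at most `1 - (1/2 - 2/9) v u²`, and `(5/18) v ≥ (5/36) (1 - e) ≥ (1 - e) / 8`.
  nlinarith [sq_nonneg u, mul_le_mul_of_nonneg_left hv0 (sq_nonneg u)]

/-- Anti-concentration of `cosDefectSum` at scales above a constant. -/
lemma cauchyLaw_abs_sub_le_le {D : ℕ} (hD : 0 < D) {z : ℝ} (hz : 0 < z) (a : ℝ) {L : ℝ}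
    (hL : 2 ≤ L) :
    (cauchyLaw D).real {t | |cosDefectSum z t - a| ≤ L} ≤
      2 * √(Real.pi / (D * (1 - Real.exp (-z)) / (8 * L ^ 2))) := by
  have hL0 : 0 < L := by linarith
  have he1 : Real.exp (-z) < 1 := by simpa using hz
  have hD' : (0 : ℝ) < D := by exact_mod_cast hD
  have hset : {t : Fin D → ℝ | |cosDefectSum z t - a| ≤ L} =
      {t | |(cosDefectSum z t - a) / L| ≤ 1} := by
    ext t
    simp only [Set.mem_ofPred_eq]
    rw [abs_div, abs_of_pos hL0, div_le_one hL0]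
  rw [hset]
  refine measureReal_abs_le_one_le _ (by fun_prop)
    (div_pos (mul_pos hD' (by linarith)) (by positivity)) fun r hr => ?_
  have hu : |r / L| ≤ 1 / 2 := by
    rw [abs_div, abs_of_pos hL0, div_le_iff₀ hL0]; linarith
  have hfac : ∀ t : Fin D → ℝ,
      Complex.exp (((r * ((cosDefectSum z t - a) / L) : ℝ) : ℂ) * Complex.I) =
      Complex.exp (((-(r * a / L) : ℝ) : ℂ) * Complex.I) *
        ∏ k, Complex.exp (((r / L * (1 - Real.cos (z * t k)) : ℝ) : ℂ) * Complex.I) := by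
    intro t
    rw [← Complex.exp_sum, ← Complex.exp_add, ← Finset.sum_mul, ← Complex.ofReal_sum,
      ← Finset.mul_sum, ← add_mul, ← Complex.ofReal_add, ← cosDefectSum]
    congr 3; ring
  have hre : ∫ t, Real.cos (r * ((cosDefectSum z t - a) / L)) ∂(cauchyLaw D) =
      (∫ t, Complex.exp (((r * ((cosDefectSum z t - a) / L) : ℝ) : ℂ) * Complex.I)
        ∂(cauchyLaw D)).re := by
    rw [← RCLike.re_eq_complex_re, ← integral_re]
    · congr 1; ext t
      rw [RCLike.re_eq_complex_re, Complex.exp_ofReal_mul_I_re]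
    · exact Integrable.of_bound (C := 1) (by fun_prop)
        (ae_of_all _ fun t => (Complex.norm_exp_ofReal_mul_I _).le)
  rw [hre]
  refine (Complex.re_le_norm _).trans ?_
  simp_rw [hfac]
  rw [integral_const_mul, norm_mul, Complex.norm_exp_ofReal_mul_I, one_mul,
    integral_fintype_prod_eq_pow (fun s => Complex.exp
      (((r / L * (1 - Real.cos (z * s)) : ℝ) : ℂ) * Complex.I)), norm_pow, Fintype.card_fin]
  refine (pow_le_pow_left₀ (norm_nonneg _) (norm_integral_exp_cos_stdCauchy_le hz hu) D).trans_eq ?_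
  rw [← Real.exp_nat_mul]
  congr 1
  field_simp

/-! ### Small frequencies, large frequencies and the union bound. -/

/-- Use `1 - cos x ≤ x² / 2`: for `z ≤ 1` with the truncated second moment, for `z ≥ 1` pointwise.
-/
lemma integral_indicator_one_sub_cos_le {z δ : ℝ} (hz : 0 < z) (hδ : 0 < δ) (hδ1 : δ ≤ 1) :
    ∫ s, {s : ℝ | |s| ≤ δ / z}.indicator (fun s => 1 - Real.cos (z * s)) s ∂stdCauchy ≤
      δ * (1 - Real.exp (-z)) := by
  have hm := min_le_two_mul_one_sub_exp hz.le
  have hms : MeasurableSet {s : ℝ | |s| ≤ δ / z} := measurableSet_le (by fun_prop) (by fun_prop)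
  have hcos : Integrable (fun s => 1 - Real.cos (z * s)) stdCauchy :=
    (integrable_const _).sub
      (Integrable.of_bound (C := 1) (by fun_prop) (ae_of_all _ fun p => Real.abs_cos_le_one _))
  have hq : ∀ s, 1 - Real.cos (z * s) ≤ z ^ 2 / 2 * s ^ 2 := fun s => by
    have := Real.one_sub_sq_div_two_le_cos (x := z * s)
    nlinarith
  rcases le_total z 1 with h | h
  · rw [min_eq_right h] at hm
    have hsq : Integrable ({s : ℝ | |s| ≤ δ / z}.indicator fun s => s ^ 2) stdCauchy := by
      refine Integrable.of_bound (C := (δ / z) ^ 2)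
        ((by fun_prop : Measurable fun s : ℝ => s ^ 2).indicator hms).aestronglyMeasurable
        (ae_of_all _ fun s => ?_)
      by_cases hs : s ∈ {s : ℝ | |s| ≤ δ / z}
      · rw [Set.indicator_of_mem hs, Real.norm_eq_abs, abs_pow]
        exact pow_le_pow_left₀ (abs_nonneg _) hs 2
      · rw [Set.indicator_of_notMem hs, norm_zero]; positivity
    calc _ ≤ ∫ s, z ^ 2 / 2 * {s : ℝ | |s| ≤ δ / z}.indicator (fun s => s ^ 2) s ∂stdCauchy := by
          refine integral_mono (hcos.indicator hms) (hsq.const_mul _) fun s => ?_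
          by_cases hs : s ∈ {s : ℝ | |s| ≤ δ / z}
          · simpa only [Set.indicator_of_mem hs] using hq s
          · simp only [Set.indicator_of_notMem hs, mul_zero, le_refl]
      _ ≤ z ^ 2 / 2 * (δ / z) := by
          rw [integral_const_mul]
          exact mul_le_mul_of_nonneg_left (integral_indicator_sq_stdCauchy (by positivity))
            (by positivity)
      _ = δ * (z / 2) := by field_simp
      _ ≤ _ := mul_le_mul_of_nonneg_left (by linarith) hδ.le
  · rw [min_eq_left h] at hm
    calc _ ≤ ∫ _s, δ ^ 2 / 2 ∂stdCauchy := by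
          refine integral_mono (hcos.indicator hms) (integrable_const _) fun s => ?_
          by_cases hs : s ∈ {s : ℝ | |s| ≤ δ / z}
          swap
          · rw [Set.indicator_of_notMem hs]; positivity
          rw [Set.indicator_of_mem hs]
          refine (hq s).trans ?_
          have : |z * s| ≤ δ := by
            rw [abs_mul, abs_of_pos hz, mul_comm]; exact (le_div_iff₀ hz).1 hs
          have := pow_le_pow_left₀ (abs_nonneg _) this 2
          rw [sq_abs] at this
          linarith
      _ = δ * (δ / 2) := by simp; ring
      _ ≤ _ := mul_le_mul_of_nonneg_left (by linarith) hδ.le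

/-- If all frequencies are small, the sum is unlikely to reach a given level. -/
lemma cauchyLaw_small_frequencies_le {D : ℕ} {z δ a : ℝ} (hz : 0 < z) (hδ : 0 < δ) (hδ1 : δ ≤ 1)
    (ha : 0 < a) :
    (cauchyLaw D).real {t | a ≤ cosDefectSum z t ∧ ∀ k, |t k| ≤ δ / z} ≤
      D * (δ * (1 - Real.exp (-z))) / a := by
  set A : Set ℝ := {s : ℝ | |s| ≤ δ / z}
  set g : ℝ → ℝ := A.indicator fun s => 1 - Real.cos (z * s)
  have hms : MeasurableSet A := measurableSet_le (by fun_prop) (by fun_prop)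
  have hgi : Integrable g stdCauchy := ((integrable_const _).sub
      (Integrable.of_bound (C := 1) (by fun_prop)
        (ae_of_all _ fun p => Real.abs_cos_le_one _))).indicator hms
  have hg0 : ∀ s, 0 ≤ g s :=
    Set.indicator_nonneg fun s _ => by linarith [Real.cos_le_one (z * s)]
  have hgk : ∀ k : Fin D, Integrable (fun t : Fin D → ℝ => g (t k)) (cauchyLaw D) :=
    fun k => integrable_comp_eval (i := k) hgi
  have hsum : ∫ t : Fin D → ℝ, ∑ k, g (t k) ∂(cauchyLaw D) ≤ D * (δ * (1 - Real.exp (-z))) := by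
    rw [integral_finsetSum _ fun k _ => hgk k]
    have : ∀ k : Fin D, ∫ t : Fin D → ℝ, g (t k) ∂(cauchyLaw D) = ∫ s, g s ∂stdCauchy :=
      fun k => integral_comp_eval (i := k) hgi.aestronglyMeasurable
    simp_rw [this]
    simp only [Finset.sum_const, Finset.card_univ, Fintype.card_fin, nsmul_eq_mul]
    exact mul_le_mul_of_nonneg_left (integral_indicator_one_sub_cos_le hz hδ hδ1) (by positivity)
  rw [le_div_iff₀ ha, mul_comm]
  refine le_trans ?_ hsum
  refine le_trans ?_ (mul_meas_ge_le_integral_of_nonneg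
    (ae_of_all _ fun t => Finset.sum_nonneg fun k _ => hg0 _)
    (integrable_finsetSum _ fun k _ => hgk k) a)
  refine mul_le_mul_of_nonneg_left (measureReal_mono fun t ht => ?_) ha.le
  obtain ⟨h1, h2⟩ := ht
  refine h1.trans_eq (Finset.sum_congr rfl fun k _ => ?_)
  exact (Set.indicator_of_mem (show t k ∈ A from h2 k) fun s => 1 - Real.cos (z * s)).symm

lemma stdCauchy_real_div_lt_abs_le {z δ : ℝ} (hz : 0 < z) (hδ : 0 < δ) (hδ1 : δ ≤ 1) :
    stdCauchy.real {s | δ / z < |s|} ≤ 2 * (1 - Real.exp (-z)) / δ := by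
  have hm := min_le_two_mul_one_sub_exp hz.le
  rcases le_total z 1 with h | h
  · rw [min_eq_right h] at hm
    refine (stdCauchy_real_abs_gt (by positivity)).trans ?_
    rw [one_div_div]
    gcongr
  · rw [min_eq_left h] at hm
    refine measureReal_le_one.trans ?_
    rw [le_div_iff₀ hδ]; linarith

/-- On a half period the cosine separates points at least quadratically. -/
lemma two_mul_sq_div_pi_le_abs_cos_sub_cos {j : ℤ} {x y : ℝ}
    (hx : x ∈ Set.Icc (j * Real.pi) ((j + 1) * Real.pi))
    (hy : y ∈ Set.Icc (j * Real.pi) ((j + 1) * Real.pi)) (hxy : x ≤ y) :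
    2 * ((y - x) / Real.pi) ^ 2 ≤ |Real.cos x - Real.cos y| := by
  have hpi := Real.pi_pos
  obtain ⟨hx1, -⟩ := hx
  obtain ⟨-, hy2⟩ := hy
  -- The cosine difference is `±2 sin q sin h` with `h ≤ q ≤ π - h`, so both sines are at least `2h
  -- / π`.
  set h := (y - x) / 2 with hh
  set q := (x + y) / 2 - j * Real.pi with hq
  have h0 : 0 ≤ h := by linarith
  have h1 : h ≤ Real.pi / 2 := by linarith
  have hsin : 2 / Real.pi * h ≤ Real.sin h := Real.mul_le_sin h0 h1
  have hsin0 : 0 ≤ 2 / Real.pi * h := by positivity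
  have hqsin : Real.sin h ≤ Real.sin q := by
    have hq1 : h ≤ q := by linarith
    have hq2 : q ≤ Real.pi - h := by linarith
    rcases le_total q (Real.pi / 2) with hc | hc
    · exact Real.sin_le_sin_of_le_of_le_pi_div_two (by linarith) hc hq1
    · rw [← Real.sin_pi_sub q]
      exact Real.sin_le_sin_of_le_of_le_pi_div_two (by linarith) (by linarith) (by linarith)
  have hmid : |Real.sin ((x + y) / 2)| = Real.sin q := by
    rw [← abs_of_nonneg (hsin0.trans (hsin.trans hqsin)), hq, Real.sin_sub_int_mul_pi, abs_mul,
      abs_neg_one_zpow, one_mul]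
  rw [Real.cos_sub_cos, abs_mul, abs_mul, hmid, show (x - y) / 2 = -h by rw [hh]; ring,
    Real.sin_neg, abs_neg (Real.sin h), abs_of_nonneg (hsin0.trans hsin)]
  have : (2 / Real.pi * h) * (2 / Real.pi * h) ≤ Real.sin q * Real.sin h :=
    mul_le_mul (hsin.trans hqsin) hsin hsin0 (hsin0.trans (hsin.trans hqsin))
  have e : 2 / Real.pi * h = (y - x) / Real.pi := by rw [hh]; ring
  rw [e] at this
  norm_num
  linarith

/-- The Cauchy mass, away from the origin, of the frequencies whose cosine lies in a short
interval. -/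
lemma stdCauchy_real_cos_mem_interval_le {z δ L : ℝ} (hz : 0 < z) (hδ : 0 < δ) (hδ1 : δ ≤ 1)
    (c : ℝ) {N : ℕ} (hN : 0 < N) :
    stdCauchy.real {s | δ / z < |s| ∧ |1 - Real.cos (z * s) - c| ≤ L} ≤
      (2 / N + 16 * N * √L / δ ^ 2) * (1 - Real.exp (-z)) := by
  have hpi := Real.pi_pos
  have hN' : (0 : ℝ) < N := by exact_mod_cast hN
  have hN1 : (1 : ℝ) ≤ N := by exact_mod_cast hN
  have hm := min_le_two_mul_one_sub_exp hz.le
  set m := 1 - Real.exp (-z)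
  -- The factorization `z = m₀ M₀` treats `z ≤ 1` and `z ≥ 1` together.
  obtain ⟨m₀, hm₀⟩ : ∃ m₀, m₀ = min 1 z := ⟨_, rfl⟩
  obtain ⟨M₀, hM₀⟩ : ∃ M₀, M₀ = max 1 z := ⟨_, rfl⟩
  have hz0 : z = m₀ * M₀ := by rw [hm₀, hM₀, min_mul_max, one_mul]
  have hm₀0 : 0 < m₀ := hm₀ ▸ lt_min one_pos hz
  have hm₀1 : m₀ ≤ 1 := hm₀ ▸ min_le_left _ _
  have hm₀z : m₀ ≤ z := hm₀ ▸ min_le_right _ _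
  have hM₀1 : 1 ≤ M₀ := hM₀ ▸ le_max_left _ _
  have hM₀0 : 0 < M₀ := by linarith
  rw [← hm₀] at hm
  -- Beyond `K` half periods the Cauchy tail is at most `m₀ / N`; `N` trades this tail against the
  -- number of half periods left to sum over.
  let K : ℕ := ⌈N * M₀⌉₊
  have hK1 : N * M₀ ≤ K := Nat.le_ceil _
  have hNM : 1 ≤ N * M₀ := one_le_mul_of_one_le_of_one_le hN1 hM₀1
  have hK2 : (K : ℝ) ≤ N * M₀ + 1 := (Nat.ceil_lt_add_one (by positivity)).le
  have hK0 : (0 : ℝ) < K := by linarith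
  let A : ℤ → Set ℝ := fun j => {s | z * s ∈ Set.Icc (j * Real.pi) ((j + 1) * Real.pi) ∧
    δ / z < |s| ∧ |1 - Real.cos (z * s) - c| ≤ L}
  have hAm : ∀ j, MeasurableSet (A j) := by
    intro j
    have h1 : MeasurableSet {s : ℝ | z * s ∈ Set.Icc (j * Real.pi) ((j + 1) * Real.pi)} :=
      (by fun_prop : Measurable fun s : ℝ => z * s) measurableSet_Icc
    have h2 : MeasurableSet {s : ℝ | δ / z < |s|} := measurableSet_lt (by fun_prop) (by fun_prop)
    have h3 : MeasurableSet {s : ℝ | |1 - Real.cos (z * s) - c| ≤ L} :=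
      measurableSet_le (by fun_prop) (by fun_prop)
    exact h1.inter (h2.inter h3)
  have hvol : ∀ j, volume (A j) ≤ ENNReal.ofReal (Real.pi * √L / z) := by
    intro j
    refine (Real.volume_le_diam _).trans (Metric.ediam_le ?_)
    have hord : ∀ x ∈ A j, ∀ y ∈ A j, x ≤ y → y - x ≤ Real.pi * √L / z := by
      intro x hx y hy hxy
      have h1 := two_mul_sq_div_pi_le_abs_cos_sub_cos hx.1 hy.1
        (mul_le_mul_of_nonneg_left hxy hz.le)
      have h2 : |Real.cos (z * x) - Real.cos (z * y)| ≤ 2 * L := by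
        have ha := abs_le.1 hx.2.2
        have hb := abs_le.1 hy.2.2
        exact abs_le.2 ⟨by linarith, by linarith⟩
      have h3 : (z * y - z * x) / Real.pi ≤ √L := Real.le_sqrt_of_sq_le (by linarith)
      rw [div_le_iff₀ hpi] at h3
      rw [le_div_iff₀ hz]; linarith
    intro x hx y hy
    rw [edist_dist, Real.dist_eq]
    refine ENNReal.ofReal_le_ofReal ?_
    rcases le_total x y with h | h
    · rw [abs_sub_comm, abs_of_nonneg (sub_nonneg.2 h)]; exact hord x hx y hy h
    · rw [abs_of_nonneg (sub_nonneg.2 h)]; exact hord y hy x hx h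
  have hmass : ∀ j, stdCauchy.real (A j) ≤ √L / δ ^ 2 * (m₀ / M₀) := by
    intro j
    have hfin : volume (A j) ≠ ⊤ := ((hvol j).trans_lt ENNReal.ofReal_lt_top).ne
    have hvr : volume.real (A j) ≤ Real.pi * √L / z :=
      ENNReal.toReal_le_of_le_ofReal (by positivity) (hvol j)
    -- Off `|s| ≤ δ / z`, `(1 + s²)⁻¹` is at most both `1` and `z² / δ²`.
    have hdens : ∀ s ∈ A j, stdCauchyDensity s ≤ Real.pi⁻¹ * (m₀ ^ 2 / δ ^ 2) := by
      intro s hs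
      refine mul_le_mul_of_nonneg_left ?_ (by positivity)
      have h1 : δ < z * |s| := by rw [mul_comm]; exact (div_lt_iff₀ hz).1 hs.2.1
      have h2 : δ ^ 2 ≤ z ^ 2 * s ^ 2 := by
        rw [← sq_abs s, ← mul_pow]; exact pow_le_pow_left₀ hδ.le h1.le 2
      have h3 : δ ^ 2 ≤ 1 := pow_le_one₀ hδ.le hδ1
      rw [inv_le_comm₀ (by positivity) (by positivity), inv_div,
        div_le_iff₀ (by positivity)]
      rcases le_total z 1 with h | h
      · rw [show m₀ = z by rw [hm₀, min_eq_right h]]; nlinarith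
      · rw [show m₀ = 1 by rw [hm₀, min_eq_left h]]; nlinarith [sq_nonneg s]
    refine (stdCauchy_real_le_mul_volume (hAm j) hfin hdens).trans ?_
    calc _ ≤ Real.pi⁻¹ * (m₀ ^ 2 / δ ^ 2) * (Real.pi * √L / z) := by gcongr
      _ = _ := by rw [hz0]; field_simp
  have hcover : {s | δ / z < |s| ∧ |1 - Real.cos (z * s) - c| ≤ L} ⊆
      {s | K * Real.pi / z < |s|} ∪ ⋃ j ∈ Finset.Icc (-(K : ℤ)) K, A j := by
    intro s hs
    rcases lt_or_ge (K * Real.pi / z) |s| with h | h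
    · exact Or.inl h
    right
    simp only [Set.mem_iUnion, Finset.mem_Icc, exists_prop]
    have hb : |z * s| ≤ K * Real.pi := by
      rw [abs_mul, abs_of_pos hz, mul_comm]; exact (le_div_iff₀ hz).1 h
    obtain ⟨hb1, hb2⟩ := abs_le.1 hb
    refine ⟨⌊z * s / Real.pi⌋, ⟨?_, ?_⟩, ⟨?_, ?_⟩, hs⟩
    · rw [Int.le_floor, le_div_iff₀ hpi]; push_cast; linarith
    · have : (⌊z * s / Real.pi⌋ : ℝ) ≤ K :=
        (Int.floor_le _).trans ((div_le_iff₀ hpi).2 hb2)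
      exact_mod_cast this
    · exact (le_div_iff₀ hpi).1 (Int.floor_le _)
    · exact (div_le_iff₀ hpi).1 (Int.lt_floor_add_one _).le
  have htail : stdCauchy.real {s | K * Real.pi / z < |s|} ≤ 2 / N * m := by
    refine (stdCauchy_real_abs_gt (by positivity)).trans ?_
    rw [one_div_div]
    calc z / (K * Real.pi) ≤ z / (N * M₀ * 1) := by
          gcongr; linarith [Real.pi_gt_three]
      _ = m₀ / N := by rw [hz0]; field_simp
      _ ≤ 2 * m / N := by gcongr
      _ = _ := by ring
  have hU : stdCauchy.real (⋃ j ∈ Finset.Icc (-(K : ℤ)) K, A j) ≤ 16 * N * √L / δ ^ 2 * m := by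
    refine (measureReal_biUnion_finset_le _ _).trans
      ((Finset.sum_le_card_nsmul _ _ _ fun j _ => hmass j).trans ?_)
    rw [Int.card_Icc, nsmul_eq_mul, show (K : ℤ) + 1 - -K = ((2 * K + 1 : ℕ) : ℤ) by push_cast; ring,
      Int.toNat_natCast]
    push_cast
    calc (2 * (K : ℝ) + 1) * (√L / δ ^ 2 * (m₀ / M₀))
        ≤ (8 * (N * M₀)) * (√L / δ ^ 2 * (m₀ / M₀)) := by gcongr; linarith
      _ = 8 * N * √L / δ ^ 2 * m₀ := by field_simp
      _ ≤ 8 * N * √L / δ ^ 2 * (2 * m) := by gcongr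
      _ = _ := by ring
  refine (measureReal_mono hcover).trans ((measureReal_union_le _ _).trans ?_)
  rw [add_mul]
  exact add_le_add htail hU

/-- Fubini in one coordinate: a bound for every translate gives a bound for the sum. -/
lemma cauchyLaw_coord_le {D : ℕ} (k : Fin D) {z L κ : ℝ} {B : Set ℝ} (hB : MeasurableSet B)
    (hκ : ∀ c, stdCauchy.real {s | s ∈ B ∧ |1 - Real.cos (z * s) - c| ≤ L} ≤ κ) (a : ℝ) :
    (cauchyLaw D).real {t | t k ∈ B ∧ |cosDefectSum z t - a| ≤ L} ≤ κ := by
  obtain ⟨n, rfl⟩ : ∃ n, D = n + 1 := ⟨D - 1, by have := k.2; omega⟩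
  have hκ0 : 0 ≤ κ := measureReal_nonneg.trans (hκ 0)
  have hmp := (measurePreserving_piFinSuccAbove (fun _ : Fin (n + 1) => stdCauchy) k).symm
  set E : Set (Fin (n + 1) → ℝ) := {t | t k ∈ B ∧ |cosDefectSum z t - a| ≤ L}
  have hE : MeasurableSet E := by
    have h1 : MeasurableSet {t : Fin (n + 1) → ℝ | t k ∈ B} :=
      (by fun_prop : Measurable fun t : Fin (n + 1) → ℝ => t k) hB
    have h2 : MeasurableSet {t : Fin (n + 1) → ℝ | |cosDefectSum z t - a| ≤ L} :=
      measurableSet_le (by fun_prop) (by fun_prop)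
    exact h1.inter h2
  rw [measureReal_def, cauchyLaw, ← hmp.measure_preimage hE.nullMeasurableSet,
    Measure.prod_apply_symm (hmp.measurable hE)]
  refine ENNReal.toReal_le_of_le_ofReal hκ0 ?_
  refine (lintegral_mono (g := fun _ => ENNReal.ofReal κ) fun u => ?_).trans_eq (by simp)
  refine ((ENNReal.le_ofReal_iff_toReal_le (measure_ne_top _ _) hκ0).2 ?_)
  refine le_trans (le_of_eq ?_) (hκ (a - cosDefectSum z u))
  -- With the other coordinates `u` frozen, the window is merely translated.
  rw [measureReal_def]
  congr 2
  ext s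
  simp only [E, Set.mem_preimage, Set.mem_ofPred_eq, cosDefectSum,
    Fin.sum_univ_succAbove _ k, MeasurableEquiv.piFinSuccAbove_symm_apply]
  simp only [Fin.insertNthEquiv_apply, Fin.insertNth_apply_same, Fin.insertNth_apply_succAbove]
  rw [show ∀ w, 1 - Real.cos (z * s) + w - a = 1 - Real.cos (z * s) - (a - w) by intro w; ring]

/-- Union bound over the frequency that is not small. -/
lemma cauchyLaw_success_le {D : ℕ} (hD : 0 < D) {z δ ε W κ : ℝ} (hz : 0 < z) (hδ : 0 < δ)
    (hδ1 : δ ≤ 1) (hε1 : ε < 1)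
    (hκ : ∀ c, stdCauchy.real {s | s ∈ {s : ℝ | δ / z < |s|} ∧ |1 - Real.cos (z * s) - c| ≤ W} ≤ κ) :
    (cauchyLaw D).real {t | |cosDefectSum z t - D * (1 - Real.exp (-z))| ≤ W ∧
        (1 - ε) ^ 2 * (D * (1 - Real.exp (-z))) ≤ cosDefectSum z t} ≤
      δ / (1 - ε) ^ 2 + D * κ := by
  have he1 : 0 < 1 - Real.exp (-z) := by simpa using hz
  set m := 1 - Real.exp (-z) with hm
  have hD' : (0 : ℝ) < D := by exact_mod_cast hD
  have hε' : 0 < 1 - ε := by linarith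
  have hcover : {t : Fin D → ℝ | |cosDefectSum z t - D * m| ≤ W ∧
      (1 - ε) ^ 2 * (D * m) ≤ cosDefectSum z t} ⊆
      {t | (1 - ε) ^ 2 * (D * m) ≤ cosDefectSum z t ∧ ∀ k, |t k| ≤ δ / z} ∪
      ⋃ k ∈ (Finset.univ : Finset (Fin D)),
        {t | t k ∈ {s : ℝ | δ / z < |s|} ∧ |cosDefectSum z t - D * m| ≤ W} := by
    intro t ht
    by_cases h : ∀ k, |t k| ≤ δ / z
    · exact Or.inl ⟨ht.2, h⟩
    · push Not at h
      obtain ⟨k, hk⟩ := h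
      exact Or.inr (Set.mem_biUnion (Finset.mem_univ k) ⟨hk, ht.1⟩)
  refine (measureReal_mono hcover).trans ((measureReal_union_le _ _).trans (add_le_add ?_ ?_))
  · refine (cauchyLaw_small_frequencies_le hz hδ hδ1 (by positivity)).trans_eq ?_
    rw [← hm]; field_simp
  · refine (measureReal_biUnion_finset_le _ _).trans ((Finset.sum_le_card_nsmul _ _ _ fun k _ =>
      cauchyLaw_coord_le k (measurableSet_lt (by fun_prop) (by fun_prop)) hκ _).trans_eq ?_)
    simp

/-- Ignores the window and uses only that some frequency is large; effective when the mean is small.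
-/
lemma cauchyLaw_success_le_of_few {D : ℕ} (hD : 0 < D) {z δ ε W : ℝ} (hz : 0 < z) (hδ : 0 < δ)
    (hδ1 : δ ≤ 1) (hε1 : ε < 1) :
    (cauchyLaw D).real {t | |cosDefectSum z t - D * (1 - Real.exp (-z))| ≤ W ∧
        (1 - ε) ^ 2 * (D * (1 - Real.exp (-z))) ≤ cosDefectSum z t} ≤
      δ / (1 - ε) ^ 2 + D * (2 * (1 - Real.exp (-z)) / δ) :=
  cauchyLaw_success_le hD hz hδ hδ1 hε1 fun _ =>
    (measureReal_mono fun _ hs => hs.1).trans (stdCauchy_real_div_lt_abs_le hz hδ hδ1)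

/-- Keeps the window; effective when the mean is bounded and `W` is small. -/
lemma cauchyLaw_success_le_of_narrow {D : ℕ} (hD : 0 < D) {z δ ε W : ℝ} (hz : 0 < z) (hδ : 0 < δ)
    (hδ1 : δ ≤ 1) (hε1 : ε < 1) {N : ℕ} (hN : 0 < N) :
    (cauchyLaw D).real {t | |cosDefectSum z t - D * (1 - Real.exp (-z))| ≤ W ∧
        (1 - ε) ^ 2 * (D * (1 - Real.exp (-z))) ≤ cosDefectSum z t} ≤
      δ / (1 - ε) ^ 2 + D * ((2 / N + 16 * N * √W / δ ^ 2) * (1 - Real.exp (-z))) :=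
  cauchyLaw_success_le hD hz hδ hδ1 hε1 fun c =>
    stdCauchy_real_cos_mem_interval_le hz hδ hδ1 c hN

/-! ### The mean is at least of order `1 / ε²`. -/

/-- If the sum is within a relative error `3 ε` of its mean with probability at least `p`, then
its mean is of order at least `1 / ε ^ 2`. -/
lemma exists_div_sq_le_mean_of_cauchyLaw_success (p : ℝ) (hp : 0 < p) :
    ∃ c : ℝ, 0 < c ∧ ∀ (D : ℕ) (z ε : ℝ), 0 < D → 0 < z → 0 < ε → ε ≤ 1 / 2 →
      p ≤ (cauchyLaw D).real {t | |cosDefectSum z t - D * (1 - Real.exp (-z))|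
          ≤ 3 * ε * (D * (1 - Real.exp (-z))) ∧
        (1 - ε) ^ 2 * (D * (1 - Real.exp (-z))) ≤ cosDefectSum z t} →
      c / ε ^ 2 ≤ D * (1 - Real.exp (-z)) := by
  -- `δ` makes the small-frequency term at most `p / 4`; `C` bounds the mean when the window is at
  -- most `2`; `N` makes the tail term at most `p / 4`; `e` is the least `ε` for which the remaining
  -- term can supply `p / 2`.
  obtain ⟨δ, hδ⟩ : ∃ δ, δ = p / 16 := ⟨_, rfl⟩
  obtain ⟨C, hC⟩ : ∃ C, C = 512 / p ^ 2 := ⟨_, rfl⟩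
  have hδ0 : 0 < δ := by rw [hδ]; positivity
  have hC0 : 0 < C := by rw [hC]; positivity
  obtain ⟨N, hN⟩ : ∃ N : ℕ, 8 * C / p < N := exists_nat_gt _
  have hN' : (0 : ℝ) < N := lt_trans (by positivity) hN
  have hN0 : 0 < N := by exact_mod_cast hN'
  obtain ⟨e, he⟩ : ∃ e, e = (p * δ ^ 2 / (32 * N * C)) ^ 2 / (3 * C) := ⟨_, rfl⟩
  have he0 : 0 < e := by rw [he]; positivity
  refine ⟨min (p ^ 2 / 1152) (p ^ 2 / 64 * e ^ 2), by positivity, ?_⟩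
  intro D z ε hD hz hε hε2 hsucc
  have hp1 : p ≤ 1 := hsucc.trans measureReal_le_one
  have hδ1 : δ ≤ 1 := by rw [hδ]; linarith
  have hε1 : ε < 1 := by linarith
  have hm0 : 0 < 1 - Real.exp (-z) := by simpa using hz
  have hD' : (0 : ℝ) < D := by exact_mod_cast hD
  have hfew := hsucc.trans (cauchyLaw_success_le_of_few hD hz hδ0 hδ1 hε1)
  have hnar := hsucc.trans (cauchyLaw_success_le_of_narrow hD hz hδ0 hδ1 hε1 hN0)
  have hspread : ∀ L, 2 ≤ L → 3 * ε * (D * (1 - Real.exp (-z))) ≤ L →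
      p ^ 2 * (D * (1 - Real.exp (-z))) ≤ 128 * L ^ 2 := by
    intro L hL hWL
    have h1 := (hsucc.trans (measureReal_mono fun t ht => ht.1.trans hWL)).trans
      (cauchyLaw_abs_sub_le_le hD hz (D * (1 - Real.exp (-z))) hL)
    have h2 := pow_le_pow_left₀ hp.le h1 2
    have hb : 0 < D * (1 - Real.exp (-z)) := by positivity
    rw [mul_pow, Real.sq_sqrt (by positivity), div_div_eq_mul_div, ← mul_div_assoc,
      le_div_iff₀ hb] at h2
    nlinarith [Real.pi_le_four, sq_nonneg L]
  set M := D * (1 - Real.exp (-z)) with hM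
  have hM0 : 0 < M := by positivity
  have hsmall : δ / (1 - ε) ^ 2 ≤ p / 4 := by
    rw [div_le_iff₀ (by nlinarith)]
    have : 1 / 4 ≤ (1 - ε) ^ 2 := by nlinarith
    rw [hδ]; nlinarith
  have hlow : p ^ 2 / 64 ≤ M := by
    have : D * (2 * (1 - Real.exp (-z)) / δ) = 32 * M / p := by rw [hM, hδ]; field_simp; ring
    rw [this] at hfew
    have h3 : 3 * p / 4 ≤ 32 * M / p := by linarith
    rw [le_div_iff₀ hp] at h3
    nlinarith
  rw [div_le_iff₀ (by positivity)]
  rcases le_total 2 (3 * ε * M) with hW | hW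
  · refine (min_le_left _ _).trans ?_
    have h1 := hspread _ hW le_rfl
    have h2 : p ^ 2 * M ≤ (1152 * (M * ε ^ 2)) * M := by nlinarith
    have := le_of_mul_le_mul_right h2 hM0
    linarith
  · refine (min_le_right _ _).trans ?_
    have h1 := hspread 2 le_rfl hW
    have hMC : M ≤ C := by rw [hC, le_div_iff₀ (by positivity)]; linarith
    have hee : e ≤ ε := by
      set R := √(3 * ε * M) with hR
      have hR0 : 0 ≤ R := Real.sqrt_nonneg _
      have e1 : D * ((2 / N + 16 * N * R / δ ^ 2) * (1 - Real.exp (-z))) =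
          2 / N * M + 16 * N * R / δ ^ 2 * M := by rw [hM]; ring
      rw [e1] at hnar
      have h2 : 2 / N * M ≤ p / 4 := by
        calc 2 / N * M ≤ 2 / N * C := by gcongr
          _ ≤ p / 4 := by
            rw [div_lt_iff₀ hp] at hN
            rw [div_mul_eq_mul_div, div_le_iff₀ hN']; linarith
      have h3 : 16 * N * R / δ ^ 2 * M ≤ 16 * N * R / δ ^ 2 * C := by gcongr
      have h4 : p / 2 ≤ 16 * N * R / δ ^ 2 * C := by linarith
      have h5 : p * δ ^ 2 / (32 * N * C) ≤ R := by
        rw [div_le_iff₀ (by positivity)]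
        rw [div_mul_eq_mul_div, le_div_iff₀ (by positivity)] at h4
        linarith
      have h6 := pow_le_pow_left₀ (by positivity) h5 2
      rw [hR, Real.sq_sqrt (by positivity)] at h6
      rw [he, div_le_iff₀ (by positivity)]
      have : ε * M ≤ ε * C := mul_le_mul_of_nonneg_left hMC hε.le
      linarith
    have : e ^ 2 ≤ ε ^ 2 := pow_le_pow_left₀ he0.le hee 2
    exact mul_le_mul hlow this (by positivity) hM0.le

/-! ### Test points and the theorem. -/

lemma isBoundedPoint_single {d : ℕ} {Δ ρ a : ℝ} (i : Fin d) (hρ : 0 < ρ) (h1 : ρ ≤ a)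
    (h2 : a ≤ Δ) : IsBoundedPoint Δ ρ (EuclideanSpace.single i a) := by
  have ha : |a| = a := abs_of_pos (by linarith)
  constructor <;> intro j <;> by_cases hj : j = i <;> simp [hj, ha, h1, h2]
  all_goals linarith

lemma isBoundedPoint_zero {d : ℕ} {Δ ρ : ℝ} (hΔ : 0 ≤ Δ) :
    IsBoundedPoint Δ ρ (0 : EuclideanSpace ℝ (Fin d)) := by
  constructor <;> simp [hΔ]

/-- For a fixed target dimension, the success probability is small at small distances. -/
lemma exists_forall_rffSuccessProb_lt {d : ℕ} {H : Type*} [NormedAddCommGroup H]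
    [InnerProductSpace ℝ H] {φ : EuclideanSpace ℝ (Fin d) → H}
    (hφ : IsFeatureMap (laplacianKernel d) φ) {p ε : ℝ} (hp : 0 < p) (hp1 : p ≤ 1) (hε : 0 < ε)
    (hε1 : ε < 1) {D : ℕ} (hD : 0 < D) :
    ∃ z₀ > 0, ∀ z, 0 < z → z ≤ z₀ → ∀ (x y : EuclideanSpace ℝ (Fin d)) (i : Fin d),
      x - y = EuclideanSpace.single i z →
        rffSuccessProb (laplacianKernel d) φ D ε x y < p := by
  have hε' : 0 < 1 - ε := by linarith
  have hD' : (0 : ℝ) < D := by exact_mod_cast hD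
  -- `δ` and the bound on `z` make each of the two terms at most `p / 4`.
  obtain ⟨δ, hδ⟩ : ∃ δ, δ = p * (1 - ε) ^ 2 / 4 := ⟨_, rfl⟩
  have hδ0 : 0 < δ := by rw [hδ]; positivity
  have hδ1 : δ ≤ 1 := by
    have : p * (1 - ε) ^ 2 ≤ 1 := mul_le_one₀ hp1 (by positivity) (by nlinarith)
    rw [hδ]; linarith
  refine ⟨p * δ / (8 * D), by positivity, fun z hz hz0 x y i hxy => ?_⟩
  refine ((rffSuccessProb_le hφ hz.le hε hε1 D hD hxy).trans
    (cauchyLaw_success_le_of_few hD hz hδ0 hδ1 hε1)).trans_lt ?_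
  have h1 : δ / (1 - ε) ^ 2 = p / 4 := by rw [hδ]; field_simp
  have hmz : 1 - Real.exp (-z) ≤ z := by linarith [Real.add_one_le_exp (-z)]
  have h2 : D * (2 * (1 - Real.exp (-z)) / δ) ≤ D * (2 * (p * δ / (8 * D)) / δ) := by
    gcongr; exact hmz.trans hz0
  have h3 : D * (2 * (p * δ / (8 * D)) / δ) = p / 4 := by field_simp; ring
  rw [h1]; linarith

/-- Lower bound for random Fourier features of the Laplacian kernel. The constant `c` depends only
on the success probability `p`; in particular `d = 1` is included, with the same constant. -/
theorem theorem1p1 (p : ℝ) (hp : 0 < p) :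
    ∃ c : ℝ, 0 < c ∧
      ∀ (d : ℕ), 1 ≤ d → ∀ (Δ ρ ε : ℝ), 0 < ρ → ρ ≤ Δ → 0 < ε → ε < 1 →
      ∀ (H : Type*) [NormedAddCommGroup H] [InnerProductSpace ℝ H] [CompleteSpace H]
        (φ : EuclideanSpace ℝ (Fin d) → H), IsFeatureMap (laplacianKernel d) φ →
      ∀ (D : ℕ),
        -- all pairs of bounded points
        ((∀ x y : EuclideanSpace ℝ (Fin d), IsBoundedPoint Δ ρ x → IsBoundedPoint Δ ρ y →
            p ≤ rffSuccessProb (laplacianKernel d) φ D ε x y) →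
          c * (1 / ε ^ 2 * (Δ / ρ)) ≤ (D : ℝ)) ∧
        -- only pairs of bounded points whose difference is bounded too, in the range `Δ ≤ 1`
        (Δ ≤ 1 → ε ≤ 1 / 2 →
          (∀ x y : EuclideanSpace ℝ (Fin d), IsBoundedPoint Δ ρ x → IsBoundedPoint Δ ρ y →
            IsBoundedPoint Δ ρ (x - y) →
            p ≤ rffSuccessProb (laplacianKernel d) φ D ε x y) →
          c * (1 / ε ^ 2 * (Δ / ρ)) ≤ (D : ℝ)) := by
  obtain ⟨c, hc, hmain⟩ := exists_div_sq_le_mean_of_cauchyLaw_success p hp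
  -- For `ε ≥ 1/2` the cap `1/4 ≤ ε²` reduces the claim at `Δ = ρ` to `D ≥ 1`.
  refine ⟨min c (1 / 4), by positivity, ?_⟩
  intro d hd Δ ρ ε hρ hρΔ hε hε1 H _ _ _ φ hφ D
  let i : Fin d := ⟨0, hd⟩
  let x : EuclideanSpace ℝ (Fin d) := EuclideanSpace.single i ρ
  have hx : IsBoundedPoint Δ ρ x := isBoundedPoint_single i hρ le_rfl hρΔ
  have h0 : IsBoundedPoint Δ ρ (0 : EuclideanSpace ℝ (Fin d)) :=
    isBoundedPoint_zero (hρ.le.trans hρΔ)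
  have hx0 : x - 0 = EuclideanSpace.single i ρ := sub_zero x
  have hDpos : p ≤ rffSuccessProb (laplacianKernel d) φ D ε x 0 → 0 < D := by
    intro h
    by_contra hD
    obtain rfl : D = 0 := by omega
    rw [rffSuccessProb_dim_zero hφ hρ hε1 hx0] at h
    linarith
  have hmean : p ≤ rffSuccessProb (laplacianKernel d) φ D ε x 0 → ε ≤ 1 / 2 →
      min c (1 / 4) / ε ^ 2 ≤ D * (1 - Real.exp (-ρ)) := fun h hε2 =>
    (div_le_div_of_nonneg_right (min_le_left _ _) (by positivity)).trans
      (hmain D ρ ε (hDpos h) hρ hε hε2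
        (h.trans (rffSuccessProb_le hφ hρ.le hε hε1 D (hDpos h) hx0)))
  constructor
  · intro h
    have hp0 := h x 0 hx h0
    have hD : (1 : ℝ) ≤ D := by exact_mod_cast hDpos hp0
    rcases hρΔ.eq_or_lt with rfl | hlt
    · rw [div_self hρ.ne', mul_one, mul_one_div]
      rcases le_total ε (1 / 2) with hε2 | hε2
      · refine (hmean hp0 hε2).trans (mul_le_of_le_one_right (by linarith) ?_)
        linarith [Real.exp_pos (-ρ)]
      · refine le_trans ?_ hD
        rw [div_le_one (by positivity)]
        exact (min_le_right _ _).trans (by nlinarith)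
    -- Two points of the same axis, `ρ` and slightly more than `ρ`, are bounded although their
    -- difference need not be.
    · exfalso
      obtain ⟨z₀, hz₀, hz⟩ := exists_forall_rffSuccessProb_lt hφ hp
        (hp0.trans measureReal_le_one) hε hε1 (hDpos hp0)
      have hpos : 0 < min z₀ (Δ - ρ) := lt_min hz₀ (by linarith)
      have hle : min z₀ (Δ - ρ) ≤ Δ - ρ := min_le_right _ _
      refine absurd (h (EuclideanSpace.single i (ρ + min z₀ (Δ - ρ))) x
        (isBoundedPoint_single i hρ (by linarith) (by linarith)) hx)
        (not_le.2 (hz _ hpos (min_le_left _ _) _ _ i ?_))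
      ext j
      by_cases hj : j = i <;> simp [x, hj]
  · intro hΔ hε2 h
    have hp0 := h x 0 hx h0 (by rwa [sub_zero])
    have h1 := hmean hp0 hε2
    have h2 : (D : ℝ) * (1 - Real.exp (-ρ)) ≤ D * ρ :=
      mul_le_mul_of_nonneg_left (by linarith [Real.add_one_le_exp (-ρ)]) (by positivity)
    have hc' : 0 < min c (1 / 4) := by positivity
    calc min c (1 / 4) * (1 / ε ^ 2 * (Δ / ρ)) = min c (1 / 4) / ε ^ 2 * Δ / ρ := by ring
      _ ≤ D * ρ * 1 / ρ := by
        gcongr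
        · linarith
        · exact h1.trans h2
      _ = D := by field_simp
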